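/- An order-enriched category is a category whose hom-sets are posets and whose composition is monotone in each variable; a functor between such categories is order-enriched if it preserves the order of the hom-posets. $\mathrm{Pos}$ denotes the order-enriched category of posets and monotone maps with the pointwise order. Let $\mathcal J$ be a small order-enriched category and let $D:\mathcal J\to\mathcal C$ and $W:\mathcal J^{\mathrm{op}}\to\mathrm{Pos}$ be order-enriched functors. A colimit of $D$ weighted by $W$ is an object $L$ of $\mathcal C$ with morphisms $l_j^x:Dj\to L$ ($j\in\mathcal J$, $x\in Wj$) such that (a) $l_j^x\le l_j^y$ whenever $x\le y$ in $Wj$, and $l_{j'}^x\cdot Dn=l_j^{Wn(x)}$ for all $n:j\to j'$ in $\mathcal J$ and $x\in Wj'$; (b) every family $a_j^x:Dj\to A$ satisfying (a) is of the form $a_j^x=t\cdot l_j^x$ for a unique $t:L\to A$; and for $t,t':L\to A$, if $t\cdot l_j^x\le t'\cdot l_j^x$ for all $j,x$, then $t\le t'$. (Equivalently, $\mathcal C(L,-)\cong \mathrm{Pos}^{\mathcal J^{\mathrm{op}}}(W,\mathcal C(D-,-))$.) The category $\mathcal C$ has weighted colimits if such a colimit exists for all such $\mathcal J$, $D$, $W$.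 **Corollary.** Each of the following order-enriched categories has weighted colimits: 1. $\mathbf{ALat}$: algebraic lattices (complete lattices in which every element is a supremum of compact elements), with maps preserving directed suprema and all infima, hom-sets ordered pointwise; 2. $\mathbf{ADom}$: bounded complete algebraic domains (posets, possibly empty, which have directed suprema, in which every subset with an upper bound has a least one, and in which each element is the directed supremum of the compact elements below it), with maps preserving directed suprema and all non-empty infima, hom-sets ordered pointwise; 3. $\mathbf{Spec}$: spectral topological spaces, with spectral maps (continuous maps for which preimages of compact open sets are compact), hom-sets ordered pointwise by the specialisation order ($x\le y$ iff every open set containing $x$ contains $y$). -/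

import Mathlib

open CategoryTheory Opposite

universe w v u v₁ u₁

/-! ### Order-enriched categories and functors -/

/-- An order-enriched category, i.e. a category enriched in posets and monotone maps: every hom-set
is partially ordered and composition is monotone in both arguments. -/
class OrderEnriched (C : Type u) [Category.{v} C] where
  homOrder (X Y : C) : PartialOrder (X ⟶ Y)
  comp_le_comp {X Y Z : C} {f f' : X ⟶ Y} {g g' : Y ⟶ Z} :
    f ≤ f' → g ≤ g' → f ≫ g ≤ f' ≫ g'

attribute [instance, reducible] OrderEnriched.homOrder

/-- A functor between order-enriched categories is order-enriched if it preserves the order of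
each hom-poset. -/
class OrderEnrichedFunctor {C : Type u} [Category.{v} C] [OrderEnriched C]
    {C' : Type u₁} [Category.{v₁} C'] [OrderEnriched C'] (F : C ⥤ C') : Prop where
  map_le_map {X Y : C} {f g : X ⟶ Y} : f ≤ g → F.map f ≤ F.map g

/-- The opposite of an order-enriched category: the direction of the morphisms is reversed, the
order on the hom-sets is kept. -/
instance OrderEnriched.opposite (C : Type u) [Category.{v} C] [OrderEnriched C] :
    OrderEnriched Cᵒᵖ where
  homOrder X Y := PartialOrder.lift (fun f : X ⟶ Y => f.unop) Quiver.Hom.unop_inj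
  comp_le_comp := fun {_ _ _ f f' g g'} hf hg =>
    OrderEnriched.comp_le_comp (f := g.unop) (f' := g'.unop) (g := f.unop) (g' := f'.unop) hg hf

/-- The category of posets and monotone maps, with the pointwise order on hom-sets. -/
instance OrderEnriched.partOrd : OrderEnriched PartOrd.{u} where
  homOrder X Y := PartialOrder.lift (fun f : X ⟶ Y => (f.hom : X →o Y)) fun _ _ h =>
    PartOrd.hom_ext h
  comp_le_comp := fun {_ _ _ f _ _ g'} hf hg x =>
    (hg (f.hom x)).trans (g'.hom.monotone (hf x))

/-! ### Weighted colimits -/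

section WeightedColimits

variable {J : Type w} [Category.{w} J] [OrderEnriched J] {C : Type u} [Category.{v} C]
  [OrderEnriched C]

/-- For a weight `W : Jᵒᵖ ⥤ Pos` and a diagram `D : J ⥤ C`, the elements of
`Pos^(Jᵒᵖ) (W, C(D -, A))`: families of morphisms `D j ⟶ A` indexed by `j` and `x ∈ W j`, monotone
in `x` and natural in `j`. -/
@[ext]
structure WeightedCocone (W : Jᵒᵖ ⥤ PartOrd.{w}) (D : J ⥤ C) (A : C) where
  leg (j : J) (x : W.obj (op j)) : D.obj j ⟶ A
  leg_mono (j : J) {x y : W.obj (op j)} : x ≤ y → leg j x ≤ leg j y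
  map_leg {j j' : J} (n : j ⟶ j') (x : W.obj (op j')) :
    D.map n ≫ leg j' x = leg j ((W.map n.op).hom x)

/-- The family obtained by composing all legs with `t`. -/
def WeightedCocone.comp {W : Jᵒᵖ ⥤ PartOrd.{w}} {D : J ⥤ C} {L A : C}
    (l : WeightedCocone W D L) (t : L ⟶ A) : WeightedCocone W D A where
  leg j x := l.leg j x ≫ t
  leg_mono j _ _ h := OrderEnriched.comp_le_comp (l.leg_mono j h) le_rfl
  map_leg n x := by rw [← Category.assoc, l.map_leg]

/-- `L`, with the family `l`, is the colimit of `D` weighted by `W`: for every `A`, the map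
`t ↦ l.comp t` is an order isomorphism from `C(L, A)` onto `Pos^(Jᵒᵖ) (W, C(D -, A))`, whose
elements are ordered pointwise. -/
structure IsWeightedColimit {W : Jᵒᵖ ⥤ PartOrd.{w}} {D : J ⥤ C} {L : C}
    (l : WeightedCocone W D L) : Prop where
  existsUnique (A : C) (a : WeightedCocone W D A) : ∃! t : L ⟶ A, l.comp t = a
  le_of_comp_le (A : C) (t t' : L ⟶ A) :
    (∀ (j : J) (x : W.obj (op j)), l.leg j x ≫ t ≤ l.leg j x ≫ t') → t ≤ t'

end WeightedColimits

/-- An order-enriched category has weighted colimits if, for every small order-enriched category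
`J`, every order-enriched diagram `D : J ⥤ C` has a colimit weighted by every order-enriched weight
`W : Jᵒᵖ ⥤ Pos`. -/
def HasWeightedColimits (C : Type u) [Category.{v} C] [OrderEnriched C] : Prop :=
  ∀ (J : Type w) [Category.{w} J] [OrderEnriched J]
    (W : Jᵒᵖ ⥤ PartOrd.{w}) [OrderEnrichedFunctor W] (D : J ⥤ C) [OrderEnrichedFunctor D],
    ∃ (L : C) (l : WeightedCocone W D L), IsWeightedColimit l

/-! ### Algebraic lattices -/

/-- Algebraic lattices: complete lattices in which every element is a supremum of compact
elements. -/
structure ALat : Type (u + 1) where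
  carrier : Type u
  [lattice : CompleteLattice carrier]
  [algebraic : IsCompactlyGenerated carrier]

attribute [instance] ALat.lattice ALat.algebraic

/-- Morphisms of algebraic lattices: maps which preserve directed suprema and all infima. -/
@[ext]
structure ALat.Hom (X Y : ALat.{u}) where
  toFun : X.carrier → Y.carrier
  preserves_directed_sup : ScottContinuous toFun
  preserves_inf (s : Set X.carrier) (a : X.carrier) : IsGLB s a → IsGLB (toFun '' s) (toFun a)

instance : Category ALat.{u} where
  Hom := ALat.Hom
  id X := ⟨id, ScottContinuous.id, fun s a h => by simpa using h⟩
  comp f g := ⟨g.toFun ∘ f.toFun, f.preserves_directed_sup.comp g.preserves_directed_sup,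
    fun s a h => by
      rw [Set.image_comp]
      exact g.preserves_inf _ _ (f.preserves_inf s a h)⟩

/-- The pointwise order on hom-sets. -/
instance : OrderEnriched ALat.{u} where
  homOrder X Y := PartialOrder.lift (fun f : ALat.Hom X Y => f.toFun) fun _ _ h => ALat.Hom.ext h
  comp_le_comp := fun {_ _ _ f _ _ g'} hf hg x =>
    (hg (f.toFun x)).trans (g'.preserves_directed_sup.monotone (hf x))

/-! ### Bounded complete algebraic domains -/

/-- Algebraic domains: every directed set has a supremum, and every element is the directed
supremum of the compact elements below it. (In particular every `x` is the directed supremum of all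
elements way below `x`, i.e. the poset is continuous.) -/
structure IsAlgebraicDomain (α : Type u) [PartialOrder α] : Prop where
  exists_isLUB_of_directed (s : Set α) : s.Nonempty → DirectedOn (· ≤ ·) s → ∃ a, IsLUB s a
  compacts_nonempty (x : α) : {y : α | y ≤ x ∧ IsCompactElement y}.Nonempty
  compacts_directed (x : α) : DirectedOn (· ≤ ·) {y : α | y ≤ x ∧ IsCompactElement y}
  isLUB_compacts (x : α) : IsLUB {y : α | y ≤ x ∧ IsCompactElement y} x

/-- Bounded complete posets: every subset with an upper bound has a least upper bound. -/
def IsBoundedComplete (α : Type u) [PartialOrder α] : Prop :=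
  ∀ s : Set α, BddAbove s → ∃ a, IsLUB s a

/-- Bounded complete algebraic domains. -/
structure ADom : Type (u + 1) where
  carrier : Type u
  [order : PartialOrder carrier]
  algebraic : IsAlgebraicDomain carrier
  boundedComplete : IsBoundedComplete carrier

attribute [instance] ADom.order

/-- Morphisms of bounded complete algebraic domains: maps which preserve directed suprema and all
non-empty infima. -/
@[ext]
structure ADom.Hom (X Y : ADom.{u}) where
  toFun : X.carrier → Y.carrier
  preserves_directed_sup : ScottContinuous toFun
  preserves_inf (s : Set X.carrier) (a : X.carrier) :
    s.Nonempty → IsGLB s a → IsGLB (toFun '' s) (toFun a)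

instance : Category ADom.{u} where
  Hom := ADom.Hom
  id X := ⟨id, ScottContinuous.id, fun s a _ h => by simpa using h⟩
  comp f g := ⟨g.toFun ∘ f.toFun, f.preserves_directed_sup.comp g.preserves_directed_sup,
    fun s a hs h => by
      rw [Set.image_comp]
      exact g.preserves_inf _ _ (hs.image _) (f.preserves_inf s a hs h)⟩

/-- The pointwise order on hom-sets. -/
instance : OrderEnriched ADom.{u} where
  homOrder X Y := PartialOrder.lift (fun f : ADom.Hom X Y => f.toFun) fun _ _ h => ADom.Hom.ext h
  comp_le_comp := fun {_ _ _ f _ _ g'} hf hg x =>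
    (hg (f.toFun x)).trans (g'.preserves_directed_sup.monotone (hf x))

/-! ### Spectral spaces -/

/-- Spectral spaces. -/
structure SpecTop : Type (u + 1) where
  carrier : Type u
  [topology : TopologicalSpace carrier]
  [spectral : SpectralSpace carrier]

attribute [instance] SpecTop.topology SpecTop.spectral

/-- The morphisms are the spectral maps: continuous maps for which preimages of compact open sets
are compact. -/
instance : Category SpecTop.{u} where
  Hom X Y := SpectralMap X.carrier Y.carrier
  id X := SpectralMap.id X.carrier
  comp f g := SpectralMap.comp g f

/-- Hom-sets are ordered pointwise by the specialisation order: `f ≤ g` iff, for every point `x`,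
every open set containing `f x` contains `g x`. -/
instance : OrderEnriched SpecTop.{u} where
  homOrder X Y :=
    { le := fun f g => ∀ x : X.carrier, ∀ U : Set Y.carrier, IsOpen U → f.toFun x ∈ U → g.toFun x ∈ U
      le_refl := fun _ _ _ _ h => h
      le_trans := fun _ _ _ h₁ h₂ x U hU h => h₂ x U hU (h₁ x U hU h)
      le_antisymm := fun f g h₁ h₂ => SpectralMap.ext fun x =>
        (inseparable_iff_forall_isOpen.2 fun U hU => ⟨h₁ x U hU, h₂ x U hU⟩).eq }
  comp_le_comp := fun {_ _ _ f _ _ g'} hf hg x U hU h =>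
    hf x (g'.toFun ⁻¹' U) (hU.preimage g'.spectral'.continuous) (hg (f.toFun x) U hU h)

/-! Each of the three categories is dual to a category of ordered algebras, and all three dualities
have one shape. An object carries a system of sets: principal filters of compact elements for
`ALat`, the same together with `∅` for `ADom`, compact open sets for `SpecTop`. These systems are
respectively meet-semilattices with top, meet-semilattices with top and bottom, and bounded
distributive lattices; the flags `e` (bottom) and `d` (joins) tell them apart. Morphisms are exactly
the maps whose preimages preserve the systems, points are exactly the filters (proper if `e`, prime
if `d`), and inclusion of preimages gives the order on morphisms.

A weighted colimit thus becomes a weighted limit of algebras, which is a subalgebra of a product: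
the families of sets `U j x` in the system of `D j` that are monotone in `x` and natural in `j`.
Such a family is one subset of the disjoint union of all copies of the `D j`, so the limit is again
a concrete set system (`isSetSystem_weightedSystem`). Its filters form the colimit object
(`isRealization_filters`), and `isWeightedColimit` gives the universal property. What is left for
each category is to check the duality, above all that filters come from points and that the filters
of any set system form an object whose own system is the given one. -/

/-! ### Set systems and their filters -/

/-- A family of sets closed under finite intersections, under `∅` if `e` holds, and under binary
unions if `d` holds. -/
structure IsSetSystem (e d : Prop) {S : Type v} (P : Set (Set S)) : Prop where
  univ_mem : Set.univ ∈ P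
  inter_mem {U V : Set S} : U ∈ P → V ∈ P → U ∩ V ∈ P
  empty_mem : e → ∅ ∈ P
  union_mem {U V : Set S} : d → U ∈ P → V ∈ P → U ∪ V ∈ P

/-- A filter in a set system, proper if `e` holds and prime if `d` holds. -/
structure IsSystemFilter (e d : Prop) {S : Type v} (P φ : Set (Set S)) : Prop where
  subset : φ ⊆ P
  univ_mem : Set.univ ∈ φ
  inter_mem {U V : Set S} : U ∈ φ → V ∈ φ → U ∩ V ∈ φ
  mem_of_subset {U V : Set S} : U ∈ φ → V ∈ P → U ⊆ V → V ∈ φ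
  empty_notMem : e → ∅ ∉ φ
  mem_or_mem {U V : Set S} : d → U ∈ P → V ∈ P → U ∪ V ∈ φ → U ∈ φ ∨ V ∈ φ

/-- The sets of `P` which contain a given point form a filter. -/
theorem isSystemFilter_mem (e d : Prop) {S : Type v} {P : Set (Set S)} (hP : IsSetSystem e d P)
    (s : S) : IsSystemFilter e d P {U | U ∈ P ∧ s ∈ U} where
  subset _ h := h.1
  univ_mem := ⟨hP.univ_mem, trivial⟩
  inter_mem hU hV := ⟨hP.inter_mem hU.1 hV.1, hU.2, hV.2⟩
  mem_of_subset hU hV h := ⟨hV, h hU.2⟩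
  empty_notMem _ h := h.2
  mem_or_mem _ hU hV h := h.2.imp (⟨hU, ·⟩) (⟨hV, ·⟩)

/-- A map `η : S → T` which induces, by taking preimages, an isomorphism from the set system `Q`
on `T` onto the set system `P` on `S`. -/
structure IsRealization {S T : Type v} (P : Set (Set S)) (Q : Set (Set T)) (η : S → T) : Prop where
  preimage_mem {V : Set T} : V ∈ Q → η ⁻¹' V ∈ P
  exists_preimage_eq {U : Set S} : U ∈ P → ∃ V ∈ Q, η ⁻¹' V = U
  subset_of_preimage_subset {V V' : Set T} : V ∈ Q → V' ∈ Q → η ⁻¹' V ⊆ η ⁻¹' V' → V ⊆ V'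

theorem IsRealization.eq_of_preimage_eq {S T : Type v} {P : Set (Set S)} {Q : Set (Set T)}
    {η : S → T} (h : IsRealization P Q η) {V V' : Set T} (hV : V ∈ Q) (hV' : V' ∈ Q)
    (hη : η ⁻¹' V = η ⁻¹' V') : V = V' :=
  (h.subset_of_preimage_subset hV hV' hη.le).antisymm (h.subset_of_preimage_subset hV' hV hη.ge)

/-- If `η` is the neighbourhood filter map into the filters of `P`, then `P` is realized by the
sets `{φ | U ∈ φ}`. -/
theorem isRealization_filters (e d : Prop) {S : Type v} {P : Set (Set S)}
    (hP : IsSetSystem e d P) {Q : Set (Set {φ : Set (Set S) // IsSystemFilter e d P φ})}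
    (hQ : ∀ V, V ∈ Q ↔ ∃ U ∈ P, V = {φ | U ∈ φ.1}) :
    IsRealization P Q fun s => ⟨_, isSystemFilter_mem e d hP s⟩ where
  preimage_mem hV := by
    obtain ⟨U, hU, rfl⟩ := (hQ _).1 hV
    convert hU using 1
    ext s
    exact and_iff_right hU
  exists_preimage_eq {U} hU := ⟨_, (hQ _).2 ⟨U, hU, rfl⟩, by ext s; exact and_iff_right hU⟩
  subset_of_preimage_subset hV hV' h := by
    obtain ⟨U, hU, rfl⟩ := (hQ _).1 hV
    obtain ⟨U', hU', rfl⟩ := (hQ _).1 hV'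
    -- The preimages under `η` are `U` and `U'` themselves, so `U ⊆ U'`, and filters are upward
    -- closed in `P`.
    exact fun φ hφ => φ.2.mem_of_subset hφ hU' fun s hs => (h (show s ∈ _ from ⟨hU, hs⟩)).2

/-! ### Weighted colimits from a duality with set systems -/

/-- A presentation of an order-enriched category by set systems: objects are sets with a set
system in which every filter is determined by a point, morphisms are the maps whose preimages
preserve the set systems, and every set system is realized by an object. -/
structure SetDuality (C : Type u) [Category.{v} C] [OrderEnriched C] (e d : Prop) where
  pts : C → Type v
  app {X Y : C} : (X ⟶ Y) → pts X → pts Y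
  app_comp {X Y Z : C} (f : X ⟶ Y) (g : Y ⟶ Z) : app (f ≫ g) = app g ∘ app f
  sets (X : C) : Set (Set (pts X))
  isSetSystem (X : C) : IsSetSystem e d (sets X)
  preimage_mem {X Y : C} (f : X ⟶ Y) {V : Set (pts Y)} : V ∈ sets Y → app f ⁻¹' V ∈ sets X
  exists_hom {X Y : C} (f : pts X → pts Y) : (∀ V ∈ sets Y, f ⁻¹' V ∈ sets X) →
    ∃ g : X ⟶ Y, app g = f
  le_iff {X Y : C} (f g : X ⟶ Y) : f ≤ g ↔ ∀ V ∈ sets Y, app f ⁻¹' V ⊆ app g ⁻¹' V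
  exists_point (X : C) (φ : Set (Set (pts X))) : IsSystemFilter e d (sets X) φ →
    ∃ x, ∀ U ∈ sets X, x ∈ U ↔ U ∈ φ
  exists_realization (S : Type v) (P : Set (Set S)) : IsSetSystem e d P →
    ∃ (L : C) (η : S → pts L), IsRealization P (sets L) η

namespace SetDuality

variable {C : Type u} [Category.{v} C] [OrderEnriched C] {e d : Prop}

theorem hom_ext (B : SetDuality C e d) {X Y : C} {f g : X ⟶ Y}
    (h : ∀ V ∈ B.sets Y, B.app f ⁻¹' V = B.app g ⁻¹' V) : f = g :=
  le_antisymm ((B.le_iff _ _).2 fun V hV => (h V hV).le)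
    ((B.le_iff _ _).2 fun V hV => (h V hV).ge)

variable {J : Type v} [Category.{v} J]

/-- The set system of families of sets `U j x ∈ B (D j)`, monotone in `x` and natural in `j`. -/
def weightedSystem (B : SetDuality C e d) (W : Jᵒᵖ ⥤ PartOrd.{v}) (D : J ⥤ C) :
    Set (Set (Σ j : J, W.obj (op j) × B.pts (D.obj j))) :=
  {U | (∀ j x, {p | ⟨j, x, p⟩ ∈ U} ∈ B.sets (D.obj j)) ∧
    (∀ j (x y : W.obj (op j)) p, x ≤ y → ⟨j, x, p⟩ ∈ U → ⟨j, y, p⟩ ∈ U) ∧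
    ∀ (j j' : J) (n : j ⟶ j') (x : W.obj (op j')) p,
      ⟨j', x, B.app (D.map n) p⟩ ∈ U ↔ ⟨j, (W.map n.op).hom x, p⟩ ∈ U}

/-- Intersections and unions are formed slice by slice, and both monotonicity and naturality survive
them. -/
theorem isSetSystem_weightedSystem (B : SetDuality C e d) (W : Jᵒᵖ ⥤ PartOrd.{v}) (D : J ⥤ C) :
    IsSetSystem e d (B.weightedSystem W D) where
  univ_mem := ⟨fun j _ => (B.isSetSystem (D.obj j)).univ_mem, fun _ _ _ _ _ _ => trivial,
    fun _ _ _ _ _ => Iff.rfl⟩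
  inter_mem hU hV := ⟨fun j x => (B.isSetSystem (D.obj j)).inter_mem (hU.1 j x) (hV.1 j x),
    fun j x y p h => And.imp (hU.2.1 j x y p h) (hV.2.1 j x y p h),
    fun j j' n x p => and_congr (hU.2.2 j j' n x p) (hV.2.2 j j' n x p)⟩
  empty_mem he := ⟨fun j _ => (B.isSetSystem (D.obj j)).empty_mem he, fun _ _ _ _ _ h => h,
    fun _ _ _ _ _ => Iff.rfl⟩
  union_mem hd hU hV := ⟨fun j x => (B.isSetSystem (D.obj j)).union_mem hd (hU.1 j x) (hV.1 j x),
    fun j x y p h => Or.imp (hU.2.1 j x y p h) (hV.2.1 j x y p h),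
    fun j j' n x p => or_congr (hU.2.2 j j' n x p) (hV.2.2 j j' n x p)⟩

/-- This transposes a cocone into a map from the system of `A` to the limit of the systems of the `D
j`. -/
theorem preimage_mem_weightedSystem (B : SetDuality C e d) {W : Jᵒᵖ ⥤ PartOrd.{v}} {D : J ⥤ C}
    {A : C} (a : WeightedCocone W D A) {V : Set (B.pts A)} (hV : V ∈ B.sets A) :
    {s | B.app (a.leg s.1 s.2.1) s.2.2 ∈ V} ∈ B.weightedSystem W D := by
  refine ⟨fun j x => B.preimage_mem (a.leg j x) hV, fun j x y p h hp => ?_, fun j j' n x p => ?_⟩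
  · exact (B.le_iff _ _).1 (a.leg_mono j h) V hV hp
  · change _ ∈ V ↔ B.app (a.leg j _) p ∈ V
    rw [← a.map_leg, B.app_comp]
    rfl

/-- The maps `D j ⟶ L` induced by a realization of the system of natural families. -/
theorem exists_weightedCocone (B : SetDuality C e d) {W : Jᵒᵖ ⥤ PartOrd.{v}} {D : J ⥤ C} {L : C}
    {η : (Σ j : J, W.obj (op j) × B.pts (D.obj j)) → B.pts L}
    (hη : IsRealization (B.weightedSystem W D) (B.sets L) η) :
    ∃ l : WeightedCocone W D L, ∀ j x p, B.app (l.leg j x) p = η ⟨j, x, p⟩ := by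
  choose leg hleg using fun (j : J) (x : W.obj (op j)) =>
    B.exists_hom (fun p => η ⟨j, x, p⟩) fun V hV => (hη.preimage_mem hV).1 j x
  refine ⟨⟨leg, fun j x y h => (B.le_iff _ _).2 fun V hV p hp => ?_, fun n x =>
    B.hom_ext fun V hV => Set.ext fun p => ?_⟩, fun j x p => congrFun (hleg j x) p⟩
  · rw [Set.mem_preimage, hleg] at hp ⊢
    exact (hη.preimage_mem hV).2.1 j x y p h hp
  · rw [Set.mem_preimage, Set.mem_preimage, B.app_comp, Function.comp_apply, hleg, hleg]
    exact (hη.preimage_mem hV).2.2 _ _ n x p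

/-- A cocone on `A` gives a homomorphism `H` from the system of `A` to that of `L`. Pulling the
filter of a point of `L` back along `H` gives a filter on `A`, hence a point of `A`; this defines
the mediating morphism. -/
theorem isWeightedColimit (B : SetDuality C e d) {W : Jᵒᵖ ⥤ PartOrd.{v}} {D : J ⥤ C} {L : C}
    {η : (Σ j : J, W.obj (op j) × B.pts (D.obj j)) → B.pts L}
    (hη : IsRealization (B.weightedSystem W D) (B.sets L) η) {l : WeightedCocone W D L}
    (hl : ∀ j x p, B.app (l.leg j x) p = η ⟨j, x, p⟩) : IsWeightedColimit l := by
  have order (A : C) (t t' : L ⟶ A)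
      (h : ∀ (j : J) (x : W.obj (op j)), l.leg j x ≫ t ≤ l.leg j x ≫ t') : t ≤ t' := by
    -- Inclusions in the system of `L` can be tested on the image of `η`, which is covered by the
    -- legs.
    refine (B.le_iff _ _).2 fun V hV => hη.subset_of_preimage_subset (B.preimage_mem t hV)
      (B.preimage_mem t' hV) fun ⟨j, x, p⟩ hp => ?_
    have := (B.le_iff _ _).1 (h j x) V hV
    simp only [B.app_comp] at this
    have := @this p
    simp only [Set.mem_preimage, Function.comp_apply, hl] at this hp ⊢
    exact this hp
  refine ⟨fun A a => ?_, order⟩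
  have hA := B.isSetSystem A
  have hL := B.isSetSystem L
  choose! H hH hHη using fun V (hV : V ∈ B.sets A) =>
    hη.exists_preimage_eq (B.preimage_mem_weightedSystem a hV)
  -- `H` preserves the operations because a set in the system of `L` is determined by its preimage
  -- under `η`.
  have key (z : B.pts L) : IsSystemFilter e d (B.sets A) {V | V ∈ B.sets A ∧ z ∈ H V} := by
    refine ⟨fun _ h => h.1, ⟨hA.univ_mem, ?_⟩, fun {U V} hU hV => ⟨hA.inter_mem hU.1 hV.1, ?_⟩,
      fun {U V} hU hV h => ⟨hV, ?_⟩, fun he h => ?_, fun {U V} hd hU hV h => ?_⟩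
    · rw [hη.eq_of_preimage_eq (hH _ hA.univ_mem) hL.univ_mem (by rw [hHη _ hA.univ_mem]; rfl)]
      trivial
    · rw [hη.eq_of_preimage_eq (hH _ (hA.inter_mem hU.1 hV.1))
        (hL.inter_mem (hH _ hU.1) (hH _ hV.1))]
      · exact ⟨hU.2, hV.2⟩
      · rw [hHη _ (hA.inter_mem hU.1 hV.1), Set.preimage_inter, hHη _ hU.1, hHη _ hV.1]
        rfl
    · refine hη.subset_of_preimage_subset (hH _ hU.1) (hH _ hV) ?_ hU.2
      rw [hHη _ hU.1, hHη _ hV]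
      exact fun s hs => h hs
    · have := h.2
      rw [hη.eq_of_preimage_eq (hH _ h.1) (hL.empty_mem he) (by rw [hHη _ h.1]; rfl)] at this
      exact this
    · have := h.2
      rw [hη.eq_of_preimage_eq (hH _ h.1) (hL.union_mem hd (hH _ hU) (hH _ hV))] at this
      · exact this.imp (⟨hU, ·⟩) (⟨hV, ·⟩)
      · rw [hHη _ h.1, Set.preimage_union, hHη _ hU, hHη _ hV]
        rfl
  choose t₀ ht₀ using fun z => B.exists_point A _ (key z)
  have hpre (V) (hV : V ∈ B.sets A) : t₀ ⁻¹' V = H V :=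
    Set.ext fun z => (ht₀ z V hV).trans (and_iff_right hV)
  obtain ⟨t, rfl⟩ := B.exists_hom t₀ fun V hV => by
    rw [hpre V hV]
    exact hH V hV
  have ht : l.comp t = a := WeightedCocone.ext <| funext fun j => funext fun x =>
    B.hom_ext fun V hV => Set.ext fun p => by
      change B.app (l.leg j x ≫ t) p ∈ V ↔ _
      rw [B.app_comp, Function.comp_apply, hl, ← Set.mem_preimage, hpre V hV, ← Set.mem_preimage,
        hHη V hV]
      rfl
  refine ⟨t, ht, fun t' ht' => ?_⟩
  have legs (j : J) (x : W.obj (op j)) : l.leg j x ≫ t' = l.leg j x ≫ t :=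
    congrFun (congrFun (congrArg WeightedCocone.leg (ht'.trans ht.symm)) j) x
  exact le_antisymm (order A _ _ fun j x => (legs j x).le) (order A _ _ fun j x => (legs j x).ge)

theorem hasWeightedColimits (B : SetDuality C e d) : HasWeightedColimits.{v, v, u} C := by
  intro J _ _ W _ D _
  obtain ⟨L, η, hη⟩ := B.exists_realization _ _ (B.isSetSystem_weightedSystem W D)
  obtain ⟨l, hl⟩ := B.exists_weightedCocone hη
  exact ⟨L, l, B.isWeightedColimit hη hl⟩

end SetDuality

/-! ### Compact elements of bounded complete algebraic domains -/

/-- Bounded complete algebraic domains which, unless `e` holds, have a greatest element. For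
`e = False` these are the algebraic lattices. -/
structure IsBoundedAlgebraicDomain (e : Prop) (α : Type u) [PartialOrder α] : Prop where
  algebraic : IsAlgebraicDomain α
  boundedComplete : IsBoundedComplete α
  exists_top : ¬e → ∃ t : α, IsTop t

/-- The principal filters generated by compact elements, together with `∅` if `e` holds. -/
def compactFilters (e : Prop) (α : Type u) [PartialOrder α] : Set (Set α) :=
  {U | (∃ c, IsCompactElement c ∧ U = Set.Ici c) ∨ e ∧ U = ∅}

section

variable {e : Prop} {α β : Type u} [PartialOrder α] [PartialOrder β]

theorem Ici_mem_compactFilters {c : α} (hc : IsCompactElement c) :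
    Set.Ici c ∈ compactFilters e α :=
  Or.inl ⟨c, hc, rfl⟩

/-- A non-empty set in the system of compact filters is generated by a compact element. -/
theorem mem_compactFilters_iff_of_nonempty {U : Set α} (hU : U.Nonempty) :
    U ∈ compactFilters e α ↔ ∃ c, IsCompactElement c ∧ U = Set.Ici c := by
  refine or_iff_left ?_
  rintro ⟨_, rfl⟩
  exact Set.not_nonempty_empty hU

namespace IsBoundedAlgebraicDomain

theorem le_of_compacts (hα : IsBoundedAlgebraicDomain e α) {x y : α}
    (h : ∀ c, IsCompactElement c → c ≤ x → c ≤ y) : x ≤ y :=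
  (hα.algebraic.isLUB_compacts x).2 fun c hc => h c hc.2 hc.1

/-- The infimum is the supremum of the lower bounds. These are bounded by any member of `s`, or by
the greatest element if `s` is empty. -/
theorem exists_isGLB (hα : IsBoundedAlgebraicDomain e α) {s : Set α} (hs : e → s.Nonempty) :
    ∃ a, IsGLB s a := by
  have : BddAbove (lowerBounds s) := by
    by_cases h : s.Nonempty
    · obtain ⟨b, hb⟩ := h
      exact ⟨b, fun x hx => hx hb⟩
    · obtain ⟨t, ht⟩ := hα.exists_top fun he => h (hs he)
      exact ⟨t, fun x _ => ht x⟩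
  obtain ⟨a, ha⟩ := hα.boundedComplete _ this
  exact ⟨a, isLUB_lowerBounds.1 ha⟩

/-- Two compact elements with a common upper bound have a join, which is compact and generates the
intersection. Without an upper bound the intersection is `∅`; a greatest element rules this out
unless `e` holds. -/
theorem isSetSystem (hα : IsBoundedAlgebraicDomain e α) :
    IsSetSystem e False (compactFilters e α) where
  univ_mem := by
    by_cases h : Nonempty α
    · obtain ⟨a⟩ := h
      -- The supremum of `∅` is the least element, which is compact.
      obtain ⟨b, hb⟩ := hα.boundedComplete ∅ ⟨a, fun _ h => h.elim⟩
      have hb' (x : α) : b ≤ x := hb.2 fun _ h => h.elim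
      exact Or.inl ⟨b, fun s u ⟨x, hx⟩ _ _ _ => ⟨x, hx, hb' x⟩, (Set.eq_univ_of_forall hb').symm⟩
    · refine Or.inr ⟨?_, Set.univ_eq_empty_iff.2 (not_nonempty_iff.1 h)⟩
      by_contra he
      exact h ⟨(hα.exists_top he).choose⟩
  inter_mem {U V} hU hV := by
    obtain ⟨c, hc, rfl⟩ | ⟨he, rfl⟩ := hU
    swap
    · exact Or.inr ⟨he, Set.empty_inter _⟩
    obtain ⟨c', hc', rfl⟩ | ⟨he, rfl⟩ := hV
    swap
    · exact Or.inr ⟨he, Set.inter_empty _⟩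
    by_cases h : (Set.Ici c ∩ Set.Ici c').Nonempty
    · obtain ⟨b, hb⟩ := hα.boundedComplete {c, c'} (by
        obtain ⟨x, hx, hx'⟩ := h
        exact ⟨x, by simp_all⟩)
      have hbx (x : α) : b ≤ x ↔ c ≤ x ∧ c' ≤ x := by
        rw [isLUB_le_iff hb]
        simp [upperBounds]
      refine Or.inl ⟨b, fun s u hs hd hu hbu => ?_, Set.ext fun x => (hbx x).symm⟩
      obtain ⟨x, hx, hcx⟩ := hc s u hs hd hu ((hbx u).1 hbu).1
      obtain ⟨y, hy, hcy⟩ := hc' s u hs hd hu ((hbx u).1 hbu).2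
      obtain ⟨z, hz, hxz, hyz⟩ := hd x hx y hy
      exact ⟨z, hz, (hbx z).2 ⟨hcx.trans hxz, hcy.trans hyz⟩⟩
    · refine Or.inr ⟨?_, Set.not_nonempty_iff_eq_empty.1 h⟩
      by_contra he
      obtain ⟨t, ht⟩ := hα.exists_top he
      exact h ⟨t, ht c, ht c'⟩
  empty_mem he := Or.inr ⟨he, rfl⟩
  union_mem := False.elim

/-- The point is the supremum of the compact `c` with `Set.Ici c ∈ φ`. They are directed because `φ`
is closed under intersections, and compactness shows that no further `Set.Ici c` contains the
supremum. -/
theorem exists_point (hα : IsBoundedAlgebraicDomain e α) {φ : Set (Set α)}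
    (hφ : IsSystemFilter e False (compactFilters e α) φ) :
    ∃ x, ∀ U ∈ compactFilters e α, x ∈ U ↔ U ∈ φ := by
  have hne : {c : α | IsCompactElement c ∧ Set.Ici c ∈ φ}.Nonempty := by
    obtain ⟨c, hc, h⟩ | ⟨he, h⟩ := hφ.subset hφ.univ_mem
    · exact ⟨c, hc, h ▸ hφ.univ_mem⟩
    · exact absurd (h ▸ hφ.univ_mem) (hφ.empty_notMem he)
  have hdir : DirectedOn (· ≤ ·) {c : α | IsCompactElement c ∧ Set.Ici c ∈ φ} := by
    rintro c ⟨hc, hcφ⟩ c' ⟨hc', hcφ'⟩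
    have hmem := hφ.inter_mem hcφ hcφ'
    obtain ⟨b, hb, h⟩ | ⟨he, h⟩ := hφ.subset hmem
    · have : b ∈ Set.Ici c ∩ Set.Ici c' := h ▸ Set.mem_Ici.2 le_rfl
      exact ⟨b, ⟨hb, h ▸ hmem⟩, this.1, this.2⟩
    · exact absurd (h ▸ hmem) (hφ.empty_notMem he)
  obtain ⟨x, hx⟩ := hα.algebraic.exists_isLUB_of_directed _ hne hdir
  refine ⟨x, ?_⟩
  rintro U (⟨c, hc, rfl⟩ | ⟨he, rfl⟩)
  · refine ⟨fun h => ?_, fun h => hx.1 ⟨hc, h⟩⟩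
    obtain ⟨c', hc', hcc'⟩ := hc _ x hne hdir hx h
    exact hφ.mem_of_subset hc'.2 (Ici_mem_compactFilters hc) (Set.Ici_subset_Ici.2 hcc')
  · exact ⟨fun h => h.elim, fun h => (hφ.empty_notMem he h).elim⟩

/-- The infimum `a` of the preimage of `Set.Ici c` lies in it, so `a ≤ x ↔ c ≤ f x`: a partial left
adjoint of `f`. It sends compact elements to compact ones because `f` preserves directed suprema. -/
theorem preimage_mem (hα : IsBoundedAlgebraicDomain e α) {f : α → β} (hf : ScottContinuous f)
    (hinf : ∀ (s : Set α) (a : α), (e → s.Nonempty) → IsGLB s a → IsGLB (f '' s) (f a))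
    {V : Set β} (hV : V ∈ compactFilters e β) : f ⁻¹' V ∈ compactFilters e α := by
  obtain ⟨c, hc, rfl⟩ | ⟨he, rfl⟩ := hV
  swap
  · exact Or.inr ⟨he, rfl⟩
  -- If `e` fails, an empty preimage is not excluded in advance: its infimum would be the greatest
  -- element, whose image is then above `c`.
  by_cases h : e → (f ⁻¹' Set.Ici c).Nonempty
  · obtain ⟨a, ha⟩ := hα.exists_isGLB h
    have hca : c ≤ f a := (hinf _ a h ha).2 (by rintro _ ⟨x, hx, rfl⟩; exact hx)
    have hax (x : α) : a ≤ x ↔ c ≤ f x := ⟨fun h => hca.trans (hf.monotone h), fun h => ha.1 h⟩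
    refine Or.inl ⟨a, fun s u hs hd hu hau => ?_, Set.ext fun x => (hax x).symm⟩
    obtain ⟨_, ⟨x, hx, rfl⟩, hcx⟩ := hc (f '' s) (f u) (hs.image f)
      (by
        rintro _ ⟨x, hx, rfl⟩ _ ⟨y, hy, rfl⟩
        obtain ⟨z, hz, hxz, hyz⟩ := hd x hx y hy
        exact ⟨f z, ⟨z, hz, rfl⟩, hf.monotone hxz, hf.monotone hyz⟩) (hf hs hd hu) ((hax u).1 hau)
    exact ⟨x, hx, (hax x).2 hcx⟩
  · rw [Classical.not_imp] at h
    exact Or.inr ⟨h.1, Set.not_nonempty_iff_eq_empty.1 h.2⟩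

theorem monotone_of_preimage_mem (hβ : IsBoundedAlgebraicDomain e β) {f : α → β}
    (hf : ∀ V ∈ compactFilters e β, f ⁻¹' V ∈ compactFilters e α) : Monotone f := by
  refine fun x y hxy => hβ.le_of_compacts fun c hc hcx => ?_
  obtain ⟨b, _, hb⟩ := (mem_compactFilters_iff_of_nonempty ⟨x, hcx⟩).1 (hf _ (Ici_mem_compactFilters hc))
  have hx : x ∈ f ⁻¹' Set.Ici c := hcx
  have : y ∈ f ⁻¹' Set.Ici c := by
    rw [hb] at hx ⊢
    exact le_trans hx hxy
  exact this

/-- For compact `c` below `f a`, the condition `c ≤ f x` means `b ≤ x` with `b` compact, so it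
already holds at some member of the directed set. -/
theorem scottContinuous_of_preimage_mem (hβ : IsBoundedAlgebraicDomain e β) {f : α → β}
    (hf : ∀ V ∈ compactFilters e β, f ⁻¹' V ∈ compactFilters e α) : ScottContinuous f := by
  intro s hs hd a ha
  have hmono := hβ.monotone_of_preimage_mem hf
  refine ⟨?_, fun y hy => hβ.le_of_compacts fun c hc hca => ?_⟩
  · rintro _ ⟨x, hx, rfl⟩
    exact hmono (ha.1 hx)
  · obtain ⟨b, hb, h⟩ := (mem_compactFilters_iff_of_nonempty ⟨a, hca⟩).1 (hf _ (Ici_mem_compactFilters hc))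
    have hbx (x : α) : c ≤ f x ↔ b ≤ x := Set.ext_iff.1 h x
    obtain ⟨x, hx, hbx'⟩ := hb s a hs hd ha ((hbx a).1 hca)
    exact ((hbx x).2 hbx').trans (hy ⟨x, hx, rfl⟩)

/-- Each preimage of `Set.Ici c` is closed under the infima in question: it is principal, or it is
empty and then cannot contain the non-empty `s`. -/
theorem isGLB_image_of_preimage_mem (hβ : IsBoundedAlgebraicDomain e β) {f : α → β}
    (hf : ∀ V ∈ compactFilters e β, f ⁻¹' V ∈ compactFilters e α) {s : Set α} {a : α}
    (hs : e → s.Nonempty) (ha : IsGLB s a) : IsGLB (f '' s) (f a) := by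
  have hmono := hβ.monotone_of_preimage_mem hf
  refine ⟨?_, fun y hy => hβ.le_of_compacts fun c hc hcy => ?_⟩
  · rintro _ ⟨x, hx, rfl⟩
    exact hmono (ha.1 hx)
  · have hcs (x : α) (hx : x ∈ s) : x ∈ f ⁻¹' Set.Ici c := hcy.trans (hy ⟨x, hx, rfl⟩)
    suffices a ∈ f ⁻¹' Set.Ici c from this
    obtain ⟨b, _, h⟩ | ⟨he, h⟩ := hf _ (Ici_mem_compactFilters hc)
    · rw [h] at hcs ⊢
      exact ha.2 hcs
    · obtain ⟨x, hx⟩ := hs he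
      exact absurd (h ▸ hcs x hx) (Set.notMem_empty x)

theorem le_iff_preimage_subset {γ : Type u} (hβ : IsBoundedAlgebraicDomain e β) {f g : γ → β} :
    f ≤ g ↔ ∀ V ∈ compactFilters e β, f ⁻¹' V ⊆ g ⁻¹' V := by
  constructor
  · rintro h V (⟨c, _, rfl⟩ | ⟨_, rfl⟩)
    · exact fun x hx => le_trans hx (h x)
    · rfl
  · exact fun h x => hβ.le_of_compacts fun c hc hcx => h _ (Ici_mem_compactFilters hc) hcx

end IsBoundedAlgebraicDomain

end

/-! ### The domain of filters of a set system -/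

section

variable {e : Prop} {S : Type u} {P : Set (Set S)}

/-- The filter of all sets of the system which contain a given one. -/
theorem isSystemFilter_principal (hP : IsSetSystem e False P) {U : Set S} (he : e → U.Nonempty) :
    IsSystemFilter e False P {V | V ∈ P ∧ U ⊆ V} where
  subset _ h := h.1
  univ_mem := ⟨hP.univ_mem, U.subset_univ⟩
  inter_mem hV hV' := ⟨hP.inter_mem hV.1 hV'.1, Set.subset_inter hV.2 hV'.2⟩
  mem_of_subset hV hV' h := ⟨hV', hV.2.trans h⟩
  empty_notMem h hU := (he h).ne_empty (Set.subset_empty_iff.1 hU.2)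
  mem_or_mem := False.elim

/-- The union of a directed family of filters is a filter. -/
theorem isSystemFilter_sUnion {s : Set {φ : Set (Set S) // IsSystemFilter e False P φ}}
    (hs : s.Nonempty) (hd : DirectedOn (· ≤ ·) s) :
    IsSystemFilter e False P {U | ∃ φ ∈ s, U ∈ φ.1} where
  subset := fun _ ⟨φ, _, h⟩ => φ.2.subset h
  univ_mem := hs.imp fun φ hφ => ⟨hφ, φ.2.univ_mem⟩
  inter_mem := by
    rintro U V ⟨φ, hφ, hU⟩ ⟨ψ, hψ, hV⟩
    obtain ⟨χ, hχ, hφχ, hψχ⟩ := hd φ hφ ψ hψ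
    exact ⟨χ, hχ, χ.2.inter_mem (hφχ hU) (hψχ hV)⟩
  mem_of_subset := fun ⟨φ, hφ, h⟩ hV hUV => ⟨φ, hφ, φ.2.mem_of_subset h hV hUV⟩
  empty_notMem := fun he ⟨φ, _, h⟩ => φ.2.empty_notMem he h
  mem_or_mem := False.elim

/-- The union of a directed family of filters is its supremum. -/
theorem isLUB_iff_of_directedOn {s : Set {φ : Set (Set S) // IsSystemFilter e False P φ}}
    (hs : s.Nonempty) (hd : DirectedOn (· ≤ ·) s)
    {χ : {φ : Set (Set S) // IsSystemFilter e False P φ}} :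
    IsLUB s χ ↔ ∀ U, U ∈ χ.1 ↔ ∃ φ ∈ s, U ∈ φ.1 := by
  have hlub : IsLUB s ⟨_, isSystemFilter_sUnion hs hd⟩ :=
    ⟨fun φ hφ U hU => ⟨φ, hφ, hU⟩, fun ψ hψ U ⟨φ, hφ, hU⟩ => hψ hφ hU⟩
  constructor
  · intro h U
    rw [h.unique hlub]
    rfl
  · intro h
    rwa [show χ = ⟨_, isSystemFilter_sUnion hs hd⟩ from Subtype.ext (Set.ext h)]

/-- The members of a proper filter are non-empty. -/
theorem IsSystemFilter.nonempty {φ : Set (Set S)} {d : Prop} (hφ : IsSystemFilter e d P φ)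
    {U : Set S} (hU : U ∈ φ) (he : e) : U.Nonempty := by
  rw [Set.nonempty_iff_ne_empty]
  rintro rfl
  exact hφ.empty_notMem he hU

theorem principal_le_iff (hP : IsSetSystem e False P) {U : Set S} (hU : U ∈ P)
    (he : e → U.Nonempty) (φ : {φ : Set (Set S) // IsSystemFilter e False P φ}) :
    (⟨_, isSystemFilter_principal hP he⟩ : {φ : Set (Set S) // IsSystemFilter e False P φ}) ≤ φ ↔
      U ∈ φ.1 :=
  ⟨fun h => h ⟨hU, le_rfl⟩, fun h _ hV => φ.2.mem_of_subset h hV.1 hV.2⟩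

theorem isCompactElement_principal (hP : IsSetSystem e False P) {U : Set S} (hU : U ∈ P)
    (he : e → U.Nonempty) :
    IsCompactElement
      (⟨_, isSystemFilter_principal hP he⟩ : {φ : Set (Set S) // IsSystemFilter e False P φ}) := by
  intro s χ hs hd hχ h
  rw [principal_le_iff hP hU he, (isLUB_iff_of_directedOn hs hd).1 hχ] at h
  obtain ⟨φ, hφ, h⟩ := h
  exact ⟨φ, hφ, (principal_le_iff hP hU he φ).2 h⟩

/-- The principal filters below a given filter are directed. -/
theorem directedOn_principal (hP : IsSetSystem e False P)
    (χ : {φ : Set (Set S) // IsSystemFilter e False P φ}) :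
    DirectedOn (· ≤ ·) (Set.range fun U : χ.1 =>
      (⟨_, isSystemFilter_principal hP (χ.2.nonempty U.2)⟩ :
        {φ : Set (Set S) // IsSystemFilter e False P φ})) := by
  rintro _ ⟨U, rfl⟩ _ ⟨V, rfl⟩
  exact ⟨_, ⟨⟨U.1 ∩ V.1, χ.2.inter_mem U.2 V.2⟩, rfl⟩,
    fun X hX => ⟨hX.1, Set.inter_subset_left.trans hX.2⟩,
    fun X hX => ⟨hX.1, Set.inter_subset_right.trans hX.2⟩⟩

theorem isLUB_principal (hP : IsSetSystem e False P)
    (χ : {φ : Set (Set S) // IsSystemFilter e False P φ}) :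
    IsLUB (Set.range fun U : χ.1 =>
      (⟨_, isSystemFilter_principal hP (χ.2.nonempty U.2)⟩ :
        {φ : Set (Set S) // IsSystemFilter e False P φ})) χ := by
  refine ⟨?_, fun ψ hψ U hU => hψ ⟨⟨U, hU⟩, rfl⟩ ⟨χ.2.subset hU, le_rfl⟩⟩
  rintro _ ⟨U, rfl⟩ V hV
  exact χ.2.mem_of_subset U.2 hV.1 hV.2

/-- A filter is the directed supremum of the principal filters below it; a compact one lies below,
hence equals, one of them. -/
theorem exists_eq_principal (hP : IsSetSystem e False P)
    {χ : {φ : Set (Set S) // IsSystemFilter e False P φ}} (hχ : IsCompactElement χ) :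
    ∃ U ∈ P, ∃ he : e → U.Nonempty, χ = ⟨_, isSystemFilter_principal hP he⟩ := by
  obtain ⟨_, ⟨U, rfl⟩, h⟩ := hχ _ χ (Set.range_nonempty_iff_nonempty.2 ⟨⟨_, χ.2.univ_mem⟩⟩) (directedOn_principal hP χ)
    (isLUB_principal hP χ) le_rfl
  exact ⟨U, χ.2.subset U.2, χ.2.nonempty U.2, h.antisymm ((isLUB_principal hP χ).1 ⟨U, rfl⟩)⟩

theorem isBoundedAlgebraicDomain_filters (hP : IsSetSystem e False P) :
    IsBoundedAlgebraicDomain e {φ : Set (Set S) // IsSystemFilter e False P φ} := by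
  have hrange (χ : {φ : Set (Set S) // IsSystemFilter e False P φ}) :
      {ψ | ψ ≤ χ ∧ IsCompactElement ψ} = Set.range fun U : χ.1 =>
      (⟨_, isSystemFilter_principal hP (χ.2.nonempty U.2)⟩ :
        {φ : Set (Set S) // IsSystemFilter e False P φ}) := by
    ext ψ
    constructor
    · rintro ⟨h, hψ⟩
      obtain ⟨U, hU, he, rfl⟩ := exists_eq_principal hP hψ
      exact ⟨⟨U, (principal_le_iff hP hU he χ).1 h⟩, rfl⟩
    · rintro ⟨U, rfl⟩
      exact ⟨(isLUB_principal hP χ).1 ⟨U, rfl⟩,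
        isCompactElement_principal hP (χ.2.subset U.2) (χ.2.nonempty U.2)⟩
  refine ⟨⟨fun s hs hd => ⟨⟨_, isSystemFilter_sUnion hs hd⟩,
    (isLUB_iff_of_directedOn hs hd).2 fun _ => Iff.rfl⟩, fun χ => ?_, fun χ => ?_, fun χ => ?_⟩,
    fun s hs => ?_, fun he => ?_⟩
  · rw [hrange]
    exact ⟨_, ⟨⟨_, χ.2.univ_mem⟩, rfl⟩⟩
  · rw [hrange]
    exact directedOn_principal hP χ
  · rw [hrange]
    exact isLUB_principal hP χ
  · obtain ⟨b, hb⟩ := hs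
    -- The supremum is the intersection of all upper bounds; the bound `b` keeps it inside `P` and
    -- proper.
    refine ⟨⟨{U | ∀ ψ ∈ upperBounds s, U ∈ ψ.1}, fun U h => b.2.subset (h b hb),
      fun ψ _ => ψ.2.univ_mem, fun hU hV ψ hψ => ψ.2.inter_mem (hU ψ hψ) (hV ψ hψ),
      fun hU hV h ψ hψ => ψ.2.mem_of_subset (hU ψ hψ) hV h,
      fun he h => b.2.empty_notMem he (h b hb), False.elim⟩,
      fun φ hφ U hU ψ hψ => hψ hφ hU, fun ψ hψ U hU => hU ψ hψ⟩
  -- The improper filter is the greatest element; it is allowed because `e` fails.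
  · exact ⟨⟨P, le_rfl, hP.univ_mem, hP.inter_mem, fun _ h _ => h, fun h => (he h).elim,
      False.elim⟩, fun ψ => ψ.2.subset⟩

theorem mem_compactFilters_filters (hP : IsSetSystem e False P)
    (V : Set {φ : Set (Set S) // IsSystemFilter e False P φ}) :
    V ∈ compactFilters e {φ : Set (Set S) // IsSystemFilter e False P φ} ↔
      ∃ U ∈ P, V = {φ | U ∈ φ.1} := by
  constructor
  · rintro (⟨c, hc, rfl⟩ | ⟨he, rfl⟩)
    · obtain ⟨U, hU, he, rfl⟩ := exists_eq_principal hP hc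
      exact ⟨U, hU, Set.ext fun φ => principal_le_iff hP hU he φ⟩
    · exact ⟨∅, hP.empty_mem he, Set.ext fun φ => iff_of_false id (φ.2.empty_notMem he)⟩
  · rintro ⟨U, hU, rfl⟩
    by_cases he : e → U.Nonempty
    · exact Or.inl ⟨_, isCompactElement_principal hP hU he,
        Set.ext fun φ => (principal_le_iff hP hU he φ).symm⟩
    · rw [Classical.not_imp, Set.not_nonempty_iff_eq_empty] at he
      exact Or.inr ⟨he.1, Set.ext fun φ =>
        iff_of_false (he.2 ▸ φ.2.empty_notMem he.1) id⟩

end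

/-! ### Compact open sets of spectral spaces -/

/-- The compact open sets of a topological space. -/
def compactOpens (X : Type u) [TopologicalSpace X] : Set (Set X) :=
  {U | IsOpen U ∧ IsCompact U}

/-- A property of sets which is stable under binary unions and holds for `∅` and for basic
neighbourhoods holds for some set between a compact set and a given neighbourhood. -/
theorem IsCompact.exists_subset_of_union {X : Type u} [TopologicalSpace X] {Q : Set (Set X)}
    (hempty : ∅ ∈ Q) (hunion : ∀ U ∈ Q, ∀ V ∈ Q, U ∪ V ∈ Q) {K : Set X} (hK : IsCompact K)
    (h : ∀ x ∈ K, ∃ U ∈ Q, U ∈ nhds x) : ∃ U ∈ Q, K ⊆ U := by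
  refine hK.induction_on (p := fun s => ∃ U ∈ Q, s ⊆ U) ⟨∅, hempty, le_rfl⟩
    (fun s t hst ⟨U, hU, ht⟩ => ⟨U, hU, hst.trans ht⟩)
    (fun s t ⟨U, hU, hs⟩ ⟨V, hV, ht⟩ => ⟨U ∪ V, hunion U hU V hV, Set.union_subset_union hs ht⟩)
    fun x hx => ?_
  obtain ⟨U, hU, hUx⟩ := h x hx
  exact ⟨U, mem_nhdsWithin_of_mem_nhds hUx, U, hU, le_rfl⟩

section

variable {X Y : Type u} [TopologicalSpace X] [TopologicalSpace Y]

theorem isSetSystem_compactOpens [SpectralSpace X] : IsSetSystem True True (compactOpens X) where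
  univ_mem := ⟨isOpen_univ, isCompact_univ⟩
  inter_mem hU hV := ⟨hU.1.inter hV.1, QuasiSeparatedSpace.inter_isCompact _ _ hU.1 hU.2 hV.1 hV.2⟩
  empty_mem _ := ⟨isOpen_empty, isCompact_empty⟩
  union_mem _ hU hV := ⟨hU.1.union hV.1, hU.2.union hV.2⟩

/-- Let `Z` be the complement of the union of all compact opens outside `φ`. A compact open set
meets `Z` exactly when it belongs to `φ`, so `Z` is irreducible and its generic point is the
required one. -/
theorem exists_point_compactOpens [SpectralSpace X] {φ : Set (Set X)}
    (hφ : IsSystemFilter True True (compactOpens X) φ) :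
    ∃ x, ∀ U ∈ compactOpens X, x ∈ U ↔ U ∈ φ := by
  have hX : IsSetSystem True True (compactOpens X) := isSetSystem_compactOpens
  have hbasis := PrespectralSpace.isTopologicalBasis (X := X)
  have key {U} (hU : U ∈ compactOpens X) :
      ((⋃₀ (compactOpens X \ φ))ᶜ ∩ U).Nonempty ↔ U ∈ φ := by
    constructor
    · rintro ⟨x, hx, hxU⟩
      by_contra h
      exact hx ⟨U, ⟨hU, h⟩, hxU⟩
    · intro h
      by_contra hemp
      -- Since `φ` is prime, the compact opens outside it are closed under unions, so by compactness
      -- a single one of them would cover `U`.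
      obtain ⟨V, hV, hUV⟩ := hU.2.exists_subset_of_union (Q := compactOpens X \ φ)
        ⟨hX.empty_mem trivial, hφ.empty_notMem trivial⟩
        (fun V hV V' hV' => ⟨hX.union_mem trivial hV.1 hV'.1, fun h =>
          (hφ.mem_or_mem trivial hV.1 hV'.1 h).elim hV.2 hV'.2⟩) (by
          intro x hx
          have : x ∈ ⋃₀ (compactOpens X \ φ) := by
            by_contra hn
            exact hemp ⟨x, hn, hx⟩
          obtain ⟨V, hV, hxV⟩ := this
          exact ⟨V, hV, hV.1.1.mem_nhds hxV⟩)
      exact hV.2 (hφ.mem_of_subset h hV.1 hUV)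
  have hclosed : IsClosed (⋃₀ (compactOpens X \ φ))ᶜ :=
    (isOpen_sUnion fun V hV => hV.1.1).isClosed_compl
  have hirr : IsIrreducible (⋃₀ (compactOpens X \ φ))ᶜ := by
    refine ⟨((key hX.univ_mem).2 hφ.univ_mem).left, fun u v hu hv => ?_⟩
    rintro ⟨x, hxZ, hx⟩ ⟨y, hyZ, hy⟩
    obtain ⟨U, hU, hxU, hUu⟩ := hbasis.exists_subset_of_mem_open hx hu
    obtain ⟨V, hV, hyV, hVv⟩ := hbasis.exists_subset_of_mem_open hy hv
    exact ((key (hX.inter_mem hU hV)).2 (hφ.inter_mem ((key hU).1 ⟨x, hxZ, hxU⟩)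
      ((key hV).1 ⟨y, hyZ, hyV⟩))).mono
      (Set.inter_subset_inter_right _ (Set.inter_subset_inter hUu hVv))
  obtain ⟨x, hx⟩ := QuasiSober.sober hirr hclosed
  exact ⟨x, fun U hU => (hx.mem_open_set_iff hU.1).trans (key hU)⟩

theorem isSpectralMap_of_preimage_mem [PrespectralSpace Y] {f : X → Y}
    (hf : ∀ V ∈ compactOpens Y, f ⁻¹' V ∈ compactOpens X) : IsSpectralMap f where
  toContinuous := PrespectralSpace.isTopologicalBasis.continuous_iff.2 fun V hV => (hf V hV).1
  isCompact_preimage_of_isOpen V hV hV' := (hf V ⟨hV, hV'⟩).2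

theorem forall_isOpen_iff_preimage_subset {Z : Type u} [PrespectralSpace Y] {f g : Z → Y} :
    (∀ (x : Z) (U : Set Y), IsOpen U → f x ∈ U → g x ∈ U) ↔
      ∀ V ∈ compactOpens Y, f ⁻¹' V ⊆ g ⁻¹' V := by
  refine ⟨fun h V hV x hx => h x V hV.1 hx, fun h x U hU hx => ?_⟩
  obtain ⟨V, hV, hxV, hVU⟩ :=
    PrespectralSpace.isTopologicalBasis.exists_subset_of_mem_open hx hU
  exact hVU (h V hV hxV)

end

/-! ### The spectrum of a set system -/

section

variable {S : Type u} {P : Set (Set S)}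

/-- The topology on prime filters generated by the sets `{φ | U ∈ φ}`. -/
instance primeFilterTopology (P : Set (Set S)) :
    TopologicalSpace {φ : Set (Set S) // IsSystemFilter True True P φ} :=
  TopologicalSpace.generateFrom {V | ∃ U ∈ P, V = {φ | U ∈ φ.1}}

theorem isTopologicalBasis_primeFilters (hP : IsSetSystem True True P) :
    TopologicalSpace.IsTopologicalBasis
      {V : Set {φ : Set (Set S) // IsSystemFilter True True P φ} | ∃ U ∈ P, V = {φ | U ∈ φ.1}} where
  exists_subset_inter := by
    rintro _ ⟨U, hU, rfl⟩ _ ⟨V, hV, rfl⟩ φ hφ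
    exact ⟨_, ⟨_, hP.inter_mem hU hV, rfl⟩, φ.2.inter_mem hφ.1 hφ.2, fun ψ hψ =>
      ⟨ψ.2.mem_of_subset hψ hU Set.inter_subset_left,
        ψ.2.mem_of_subset hψ hV Set.inter_subset_right⟩⟩
  sUnion_eq := Set.eq_univ_of_forall fun φ => ⟨_, ⟨_, hP.univ_mem, rfl⟩, φ.2.univ_mem⟩
  eq_generateFrom := rfl

theorem isOpen_setOf_mem {U : Set S} (hU : U ∈ P) :
    IsOpen {φ : {φ : Set (Set S) // IsSystemFilter True True P φ} | U ∈ φ.1} :=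
  TopologicalSpace.isOpen_generateFrom_of_mem ⟨U, hU, rfl⟩

/-- An ultrafilter `F` converges to the set of those `V` that belong to `F`-almost every `φ`. This
filter is prime because an ultrafilter decides disjunctions. -/
theorem isCompact_setOf_mem (hP : IsSetSystem True True P) {U : Set S} (hU : U ∈ P) :
    IsCompact {φ : {φ : Set (Set S) // IsSystemFilter True True P φ} | U ∈ φ.1} := by
  rw [isCompact_iff_ultrafilter_le_nhds]
  intro F hF
  have hlim : IsSystemFilter True True P
      {V | V ∈ P ∧ ∀ᶠ φ : {φ : Set (Set S) // IsSystemFilter True True P φ} in F, V ∈ φ.1} := by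
    refine ⟨fun _ h => h.1, ⟨hP.univ_mem, .of_forall fun φ => φ.2.univ_mem⟩,
      fun hV hV' => ⟨hP.inter_mem hV.1 hV'.1, ?_⟩, fun hV hV' h => ⟨hV', ?_⟩, fun _ h => ?_,
      fun {V V'} _ hV hV' h => ?_⟩
    · filter_upwards [hV.2, hV'.2] with φ h h' using φ.2.inter_mem h h'
    · filter_upwards [hV.2] with φ hφ using φ.2.mem_of_subset hφ hV' h
    · obtain ⟨φ, hφ⟩ := h.2.exists
      exact φ.2.empty_notMem trivial hφ
    · have : ∀ᶠ φ : {φ : Set (Set S) // IsSystemFilter True True P φ} in F, V ∈ φ.1 ∨ V' ∈ φ.1 :=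
        h.2.mono fun φ hφ => φ.2.mem_or_mem trivial hV hV' hφ
      exact (Ultrafilter.eventually_or.1 this).imp (⟨hV, ·⟩) (⟨hV', ·⟩)
  refine ⟨⟨_, hlim⟩, ⟨hU, Filter.le_principal_iff.1 hF⟩, ?_⟩
  rw [TopologicalSpace.nhds_generateFrom]
  refine le_iInf₂ fun V hV => Filter.le_principal_iff.2 ?_
  obtain ⟨hV, V, hVP, rfl⟩ := hV
  exact hV.2

/-- A compact open set is a finite union of basic sets, and primeness makes such a union basic
again. -/
theorem mem_compactOpens_primeFilters (hP : IsSetSystem True True P)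
    (V : Set {φ : Set (Set S) // IsSystemFilter True True P φ}) :
    V ∈ compactOpens {φ : Set (Set S) // IsSystemFilter True True P φ} ↔
      ∃ U ∈ P, V = {φ | U ∈ φ.1} := by
  constructor
  · rintro ⟨hV, hV'⟩
    obtain ⟨_, ⟨⟨U, hU, rfl⟩, h⟩, h'⟩ := hV'.exists_subset_of_union
      (Q := {V' | (∃ U ∈ P, V' = {φ : {φ : Set (Set S) // IsSystemFilter True True P φ} | U ∈ φ.1}) ∧
        V' ⊆ V})
      ⟨⟨(∅ : Set S), hP.empty_mem trivial, Set.ext fun φ =>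
        iff_of_false id (φ.2.empty_notMem trivial)⟩, Set.empty_subset V⟩ (by
        rintro _ ⟨⟨U, hU, rfl⟩, h⟩ _ ⟨⟨U', hU', rfl⟩, h'⟩
        refine ⟨⟨U ∪ U', hP.union_mem trivial hU hU', Set.ext fun φ =>
          ⟨?_, φ.2.mem_or_mem trivial hU hU'⟩⟩, Set.union_subset h h'⟩
        exact fun hφ => hφ.elim
          (fun hφ => φ.2.mem_of_subset hφ (hP.union_mem trivial hU hU') Set.subset_union_left)
          (fun hφ => φ.2.mem_of_subset hφ (hP.union_mem trivial hU hU') Set.subset_union_right))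
      fun φ hφ => by
        obtain ⟨_, ⟨U, hU, rfl⟩, hφU, h⟩ :=
          (isTopologicalBasis_primeFilters hP).exists_subset_of_mem_open hφ hV
        exact ⟨_, ⟨⟨U, hU, rfl⟩, h⟩, (isOpen_setOf_mem hU).mem_nhds hφU⟩
    exact ⟨U, hU, h'.antisymm h⟩
  · rintro ⟨U, hU, rfl⟩
    exact ⟨isOpen_setOf_mem hU, isCompact_setOf_mem hP hU⟩

/-- The generic point of `Z` consists of the `U` whose basic set meets `Z`; irreducibility is what
closes it under intersections. -/
theorem quasiSober_primeFilters (hP : IsSetSystem True True P) :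
    QuasiSober {φ : Set (Set S) // IsSystemFilter True True P φ} where
  sober {Z} hZ hZ' := by
    have hgen : IsSystemFilter True True P {U | U ∈ P ∧ ∃ φ ∈ Z, U ∈ φ.1} := by
      refine ⟨fun _ h => h.1, ⟨hP.univ_mem, hZ.1.imp fun φ hφ => ⟨hφ, φ.2.univ_mem⟩⟩, ?_, ?_, ?_,
        ?_⟩
      · rintro U V ⟨hU, hUZ⟩ ⟨hV, hVZ⟩
        obtain ⟨φ, hφ, h, h'⟩ := hZ.2 _ _ (isOpen_setOf_mem hU) (isOpen_setOf_mem hV) hUZ hVZ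
        exact ⟨hP.inter_mem hU hV, φ, hφ, φ.2.inter_mem h h'⟩
      · rintro U V ⟨_, φ, hφ, h⟩ hV hUV
        exact ⟨hV, φ, hφ, φ.2.mem_of_subset h hV hUV⟩
      · rintro - ⟨_, φ, hφ, h⟩
        exact φ.2.empty_notMem trivial h
      · rintro U V - hU hV ⟨_, φ, hφ, h⟩
        exact (φ.2.mem_or_mem trivial hU hV h).imp (⟨hU, φ, hφ, ·⟩) (⟨hV, φ, hφ, ·⟩)
    refine ⟨⟨_, hgen⟩, ?_⟩
    rw [isGenericPoint_def]
    ext ψ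
    rw [(isTopologicalBasis_primeFilters hP).mem_closure_iff]
    -- Writing `Z` as its own closure lets both sides be compared on basic open sets.
    nth_rewrite 2 [← hZ'.closure_eq]
    rw [(isTopologicalBasis_primeFilters hP).mem_closure_iff]
    constructor
    · rintro h _ ⟨U, hU, rfl⟩ hψ
      obtain ⟨_, h, rfl⟩ := h _ ⟨U, hU, rfl⟩ hψ
      obtain ⟨_, φ, hφ, hφU⟩ := h
      exact ⟨φ, hφU, hφ⟩
    · rintro h _ ⟨U, hU, rfl⟩ hψ
      obtain ⟨φ, hφU, hφ⟩ := h _ ⟨U, hU, rfl⟩ hψ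
      exact ⟨⟨_, hgen⟩, ⟨hU, φ, hφ, hφU⟩, rfl⟩

theorem spectralSpace_primeFilters (hP : IsSetSystem True True P) :
    SpectralSpace {φ : Set (Set S) // IsSystemFilter True True P φ} := by
  have hbasis := isTopologicalBasis_primeFilters hP
  have : T0Space {φ : Set (Set S) // IsSystemFilter True True P φ} := by
    refine ⟨fun φ ψ h => Subtype.ext (Set.ext fun U => ?_)⟩
    by_cases hU : U ∈ P
    · exact h.mem_open_iff (isOpen_setOf_mem hU)
    · exact iff_of_false (fun h => hU (φ.2.subset h)) fun h => hU (ψ.2.subset h)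
  have : CompactSpace {φ : Set (Set S) // IsSystemFilter True True P φ} := by
    refine ⟨?_⟩
    convert isCompact_setOf_mem hP hP.univ_mem
    exact (Set.eq_univ_of_forall fun φ => φ.2.univ_mem).symm
  have := quasiSober_primeFilters hP
  have : PrespectralSpace {φ : Set (Set S) // IsSystemFilter True True P φ} :=
    .of_isTopologicalBasis hbasis (by
      rintro _ ⟨U, hU, rfl⟩
      exact isCompact_setOf_mem hP hU)
  have : QuasiSeparatedSpace {φ : Set (Set S) // IsSystemFilter True True P φ} := by
    refine ⟨fun V V' hV hVc hV' hVc' => ?_⟩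
    obtain ⟨U, hU, rfl⟩ := (mem_compactOpens_primeFilters hP _).1 ⟨hV, hVc⟩
    obtain ⟨U', hU', rfl⟩ := (mem_compactOpens_primeFilters hP _).1 ⟨hV', hVc'⟩
    convert isCompact_setOf_mem hP (hP.inter_mem hU hU') using 1
    exact Set.ext fun φ => ⟨fun h => φ.2.inter_mem h.1 h.2, fun h =>
      ⟨φ.2.mem_of_subset h hU Set.inter_subset_left,
        φ.2.mem_of_subset h hU' Set.inter_subset_right⟩⟩
  constructor

end

/-! ### The three categories -/

theorem ALat.isBoundedAlgebraicDomain (X : ALat.{u}) :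
    IsBoundedAlgebraicDomain False X.carrier where
  algebraic :=
    { exists_isLUB_of_directed := fun s _ _ => ⟨sSup s, isLUB_sSup s⟩
      compacts_nonempty := fun x => ⟨⊥, bot_le, fun _ _ ⟨y, hy⟩ _ _ _ => ⟨y, hy, bot_le⟩⟩
      compacts_directed := fun x => by
        rintro a ⟨hax, ha⟩ b ⟨hbx, hb⟩
        refine ⟨a ⊔ b, ⟨sup_le hax hbx, fun s u hs hd hu hab => ?_⟩, le_sup_left, le_sup_right⟩
        obtain ⟨y, hy, hay⟩ := ha s u hs hd hu (le_sup_left.trans hab)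
        obtain ⟨z, hz, hbz⟩ := hb s u hs hd hu (le_sup_right.trans hab)
        obtain ⟨t, ht, hyt, hzt⟩ := hd y hy z hz
        exact ⟨t, ht, sup_le (hay.trans hyt) (hbz.trans hzt)⟩
      isLUB_compacts := fun x => by
        obtain ⟨s, hs, rfl⟩ := IsCompactlyGenerated.exists_sSup_eq x
        exact ⟨fun y hy => hy.1, fun y hy => sSup_le fun c hc => hy ⟨le_sSup hc, hs c hc⟩⟩ }
  boundedComplete s _ := ⟨sSup s, isLUB_sSup s⟩
  exists_top _ := ⟨⊤, fun _ => le_top⟩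

/-- An algebraic domain with all suprema, as an algebraic lattice. -/
noncomputable abbrev ALat.of (α : Type u) [PartialOrder α]
    (hα : IsBoundedAlgebraicDomain False α) : ALat.{u} :=
  -- The greatest element bounds every set, so bounded completeness gives all suprema.
  have hsup (s : Set α) : ∃ a, IsLUB s a :=
    hα.boundedComplete s ((hα.exists_top id).imp fun _ ht x _ => ht x)
  letI : SupSet α := ⟨fun s => (hsup s).choose⟩
  letI := completeLatticeOfSup α fun s => (hsup s).choose_spec
  { carrier := α
    algebraic := ⟨fun x => ⟨_, fun _ h => h.2, (hα.algebraic.isLUB_compacts x).sSup_eq⟩⟩ }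

/-- The duality for algebraic lattices, given by the principal filters of compact elements. -/
def ALat.setDuality : SetDuality ALat.{u} False False where
  pts X := X.carrier
  app f := ALat.Hom.toFun f
  app_comp _ _ := rfl
  sets X := compactFilters False X.carrier
  isSetSystem X := X.isBoundedAlgebraicDomain.isSetSystem
  preimage_mem {X _} f _ hV := X.isBoundedAlgebraicDomain.preimage_mem f.preserves_directed_sup
    (fun s a _ => f.preserves_inf s a) hV
  exists_hom {_ Y} f hf :=
    ⟨⟨f, Y.isBoundedAlgebraicDomain.scottContinuous_of_preimage_mem hf, fun _ _ =>
      Y.isBoundedAlgebraicDomain.isGLB_image_of_preimage_mem hf False.elim⟩, rfl⟩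
  le_iff {_ Y} _ _ := Y.isBoundedAlgebraicDomain.le_iff_preimage_subset
  exists_point X _ := X.isBoundedAlgebraicDomain.exists_point
  exists_realization _ _ hP := ⟨ALat.of _ (isBoundedAlgebraicDomain_filters hP), _,
    isRealization_filters _ _ hP (mem_compactFilters_filters hP)⟩

theorem ADom.isBoundedAlgebraicDomain (X : ADom.{u}) :
    IsBoundedAlgebraicDomain True X.carrier :=
  ⟨X.algebraic, X.boundedComplete, fun h => (h trivial).elim⟩

/-- The duality for bounded complete algebraic domains, given by the empty set and the principal
filters of compact elements. -/
def ADom.setDuality : SetDuality ADom.{u} True False where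
  pts X := X.carrier
  app f := ADom.Hom.toFun f
  app_comp _ _ := rfl
  sets X := compactFilters True X.carrier
  isSetSystem X := X.isBoundedAlgebraicDomain.isSetSystem
  preimage_mem {X _} f _ hV := X.isBoundedAlgebraicDomain.preimage_mem f.preserves_directed_sup
    (fun s a hs => f.preserves_inf s a (hs trivial)) hV
  exists_hom {_ Y} f hf :=
    ⟨⟨f, Y.isBoundedAlgebraicDomain.scottContinuous_of_preimage_mem hf, fun _ _ hs =>
      Y.isBoundedAlgebraicDomain.isGLB_image_of_preimage_mem hf fun _ => hs⟩, rfl⟩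
  le_iff {_ Y} _ _ := Y.isBoundedAlgebraicDomain.le_iff_preimage_subset
  exists_point X _ := X.isBoundedAlgebraicDomain.exists_point
  exists_realization _ _ hP :=
    ⟨{ carrier := _
       algebraic := (isBoundedAlgebraicDomain_filters hP).algebraic
       boundedComplete := (isBoundedAlgebraicDomain_filters hP).boundedComplete }, _,
      isRealization_filters _ _ hP (mem_compactFilters_filters hP)⟩

/-- The duality for spectral spaces, given by the compact open sets. -/
def SpecTop.setDuality : SetDuality SpecTop.{u} True True where
  pts X := X.carrier
  app f := SpectralMap.toFun f
  app_comp _ _ := rfl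
  sets X := compactOpens X.carrier
  isSetSystem _ := isSetSystem_compactOpens
  preimage_mem f _ hV := ⟨hV.1.preimage f.spectral'.continuous,
    hV.2.preimage_of_isOpen f.spectral' hV.1⟩
  exists_hom f hf := ⟨⟨f, isSpectralMap_of_preimage_mem hf⟩, rfl⟩
  le_iff _ _ := forall_isOpen_iff_preimage_subset
  exists_point _ _ := exists_point_compactOpens
  exists_realization _ _ hP :=
    ⟨{ carrier := _, spectral := spectralSpace_primeFilters hP }, _,
      isRealization_filters _ _ hP (mem_compactOpens_primeFilters hP)⟩

theorem mainTheorem5 :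
    HasWeightedColimits.{u, u, u + 1} ALat.{u} ∧
      HasWeightedColimits.{u, u, u + 1} ADom.{u} ∧
      HasWeightedColimits.{u, u, u + 1} SpecTop.{u} :=
  ⟨ALat.setDuality.hasWeightedColimits, ADom.setDuality.hasWeightedColimits,
    SpecTop.setDuality.hasWeightedColimits⟩
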